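/- Let $k$ be an algebraically closed field and let $\mathcal{C}$ be a pivotal finite tensor category over $k$: a rigid monoidal category with $k$-bilinear tensor product and simple unit object $\mathbf 1$ whose underlying category is a finite $k$-linear abelian category (a $k$-linear abelian category equivalent to the finite-dimensional modules over a finite-dimensional $k$-algebra), together with an isomorphism $\mathfrak{p}\colon \mathrm{id}_{\mathcal C}\to(-)^{**}$ of monoidal functors. Here $X^*$ is the left dual of $X$, with evaluation $\mathrm{ev}_X\colon X^*\otimes X\to\mathbf 1$ and coevaluation $\mathrm{coev}_X\colon\mathbf 1\to X\otimes X^*$. Let $\mathcal{M}$ be an exact left $\mathcal{C}$-module category, i.e. a finite $k$-linear abelian category with a left action $\triangleright$ of $\mathcal C$ that is $k$-bilinear and right exact in each variable, such that $P\triangleright M$ is projective whenever $P\in\mathcal C$ is projective and $M\in\mathcal M$. Let $[M,-]$ be the right adjoint of $-\triangleright M\colon\mathcal C\to\mathcal M$ (the internal Hom), so that each $[M,M]$ is an algebra in $\mathcal{C}$ under composition, with unit $u_M\colon\mathbf 1\to[M,M]$. Let $(\mathbb S,\phi)$ be a relative Serre functor of $\mathcal M$: a functor $\mathbb S\colon\mathcal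 M\to\mathcal M$ with a natural isomorphism $\phi_{M,N}\colon[M,N]^*\to[N,\mathbb S(M)]$. Let $\xi_{X,M}\colon X^{**}\triangleright\mathbb S(M)\to\mathbb S(X\triangleright M)$ be its twisted $\mathcal C$-module structure, i.e. the (necessarily unique) structure on $\mathbb S$ of a $\mathcal C$-module functor from $\mathcal M$ to $\mathcal M$ with the action twisted by $(-)^{**}$ for which $\phi$ is an isomorphism of $\mathcal C$-bimodule functors. Let $\widetilde{\mathfrak p}\colon\mathrm{id}_{\mathcal M}\to\mathbb S$ be a pivotal structure of $\mathcal M$ respecting $\mathfrak p$, i.e. a natural isomorphism with $$\widetilde{\mathfrak p}_{X\triangleright M}=\xi_{X,M}\circ(\mathfrak p_X\triangleright\widetilde{\mathfrak p}_M)\qquad(X\in\mathcal C,\ M\in\mathcal M).$$ Then for every object $M\in\mathcal M$ the algebra $A=[M,M]$, with multiplication $\mu$, is a symmetric Frobenius algebra in $\mathcal C$ with Frobenius form $$\lambda_M=\Big([M,M]\xrightarrow{\ [M,\widetilde{\mathfrak p}_M]\ }[M,\mathbb S(M)]\xrightarrow{\ \mathrm{tr}_M\ }\mathbf 1\Big),\qquad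 \mathrm{tr}_M=\Big([M,\mathbb S(M)]\xrightarrow{\ \phi_{M,M}^{-1}\ }[M,M]^*\xrightarrow{\ u_M^*\ }\mathbf 1^*\cong\mathbf 1\Big).$$ That is, the morphism $\psi=(\lambda_M\mu\otimes\mathrm{id}_{A^*})\circ(\mathrm{id}_A\otimes\mathrm{coev}_A)\colon A\to A^*$ is an isomorphism, and the Nakayama automorphism $\mathfrak p_A^{-1}\circ(\psi^{-1})^*\circ\psi$ of $A$ is the identity. -/

import Mathlib

open CategoryTheory MonoidalCategory MonoidalLeftAction Limits

universe w v v' u u'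

namespace RelSerre

noncomputable section Duality

lemma rightDualIso_ev {C : Type u} [Category.{v} C] [MonoidalCategory C] {X Y₁ Y₂ : C} (p₁ : ExactPairing X Y₁)
    (p₂ : ExactPairing X Y₂) :
    (rightDualIso p₁ p₂).hom ▷ X ≫ p₂.evaluation' = p₁.evaluation' := by
  have h := @rightAdjointMate_comp_evaluation C _ _ X X ⟨Y₂⟩ ⟨Y₁⟩ (𝟙 X)
  rw [MonoidalCategory.whiskerLeft_id, Category.id_comp] at h
  exact h

variable {C : Type u} [Category.{v} C] [MonoidalCategory C] [RigidCategory C]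

/-- The chosen dual `X^*` of `X`, with evaluation `X^* ⊗ X ⟶ 𝟙` and coevaluation `𝟙 ⟶ X ⊗ X^*`.
(This is a *left* dual in the convention of Etingof-Gelaki-Nikshych-Ostrik, and it is called
a *right* dual in Mathlib.) -/
def dual (X : C) : C := Xᘁ

/-- The evaluation `X^* ⊗ X ⟶ 𝟙`. -/
def ev (X : C) : dual X ⊗ X ⟶ 𝟙_ C := ε_ X Xᘁ

/-- The coevaluation `𝟙 ⟶ X ⊗ X^*`. -/
def coev (X : C) : 𝟙_ C ⟶ X ⊗ dual X := η_ X Xᘁ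

/-- The dual `f^* : Y^* ⟶ X^*` of a morphism `f : X ⟶ Y`. -/
def dualMap {X Y : C} (f : X ⟶ Y) : dual Y ⟶ dual X := fᘁ

lemma dualMap_id (X : C) : dualMap (𝟙 X) = 𝟙 (dual X) := rightAdjointMate_id

lemma dualMap_comp {X Y Z : C} (f : X ⟶ Y) (g : Y ⟶ Z) :
    dualMap (f ≫ g) = dualMap g ≫ dualMap f := comp_rightAdjointMate

/-- The canonical isomorphism `𝟙 ≅ 𝟙^*`. -/
def dualUnitIso : 𝟙_ C ≅ dual (𝟙_ C) :=
  rightDualIso exactPairingUnit (RightRigidCategory.rightDual (𝟙_ C)).exact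

/-- The canonical isomorphism `Y^* ⊗ X^* ≅ (X ⊗ Y)^*`. -/
def dualTensorIso (X Y : C) : dual Y ⊗ dual X ≅ dual (X ⊗ Y) :=
  (rightDualTensorIso X Y).symm

lemma dualMap_ev {X Y : C} (f : X ⟶ Y) : dualMap f ▷ X ≫ ev X = dual Y ◁ f ≫ ev Y :=
  rightAdjointMate_comp_evaluation f

lemma dual_hom_ext {Z X : C} {f g : Z ⟶ dual X} (h : f ▷ X ≫ ev X = g ▷ X ≫ ev X) : f = g := by
  have aux : ∀ f g : Z ⟶ Xᘁ, f ▷ X ≫ ε_ X Xᘁ = g ▷ X ≫ ε_ X Xᘁ → f = g := by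
    intro f g h
    have hf := tensorRightHomEquiv_whiskerRight_comp_evaluation f
    have hg := tensorRightHomEquiv_whiskerRight_comp_evaluation g
    rw [h, hg] at hf
    exact ((cancel_mono _).mp hf).symm
  exact aux f g h

lemma dualUnitIso_ev : (dualUnitIso (C := C)).hom ▷ 𝟙_ C ≫ ev (𝟙_ C) = (ρ_ (𝟙_ C)).hom :=
  rightDualIso_ev exactPairingUnit (RightRigidCategory.rightDual (𝟙_ C)).exact

lemma dualTensorIso_ev (X Y : C) :
    (dualTensorIso X Y).hom ▷ (X ⊗ Y) ≫ ev (X ⊗ Y) =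
      𝟙 _ ⊗≫ dual Y ◁ (ev X ▷ Y) ⊗≫ ev Y :=
  rightDualIso_ev (X := X ⊗ Y) ExactPairing.tensor (HasRightDual.exact)

lemma dualTensorIso_naturality_left {X X' : C} (f : X ⟶ X') (Y : C) :
    dual Y ◁ dualMap f ≫ (dualTensorIso X Y).hom =
      (dualTensorIso X' Y).hom ≫ dualMap (f ▷ Y) := by
  apply dual_hom_ext
  rw [comp_whiskerRight, comp_whiskerRight, Category.assoc, Category.assoc, dualTensorIso_ev,
    dualMap_ev, ← whisker_exchange_assoc, dualTensorIso_ev]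
  calc
    _ = 𝟙 _ ⊗≫ dual Y ◁ ((dualMap f ▷ X ≫ ev X) ▷ Y) ⊗≫ ev Y := by monoidal
    _ = _ := by rw [dualMap_ev]; monoidal

lemma dualTensorIso_naturality_right (X : C) {Y Y' : C} (g : Y ⟶ Y') :
    dualMap g ▷ dual X ≫ (dualTensorIso X Y).hom =
      (dualTensorIso X Y').hom ≫ dualMap (X ◁ g) := by
  apply dual_hom_ext
  rw [comp_whiskerRight, comp_whiskerRight, Category.assoc, Category.assoc, dualTensorIso_ev,
    dualMap_ev, ← whisker_exchange_assoc, dualTensorIso_ev]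
  calc
    _ = 𝟙 _ ⊗≫ (dualMap g ▷ ((dual X ⊗ X) ⊗ Y) ≫ dual Y ◁ (ev X ▷ Y)) ⊗≫ ev Y := by monoidal
    _ = 𝟙 _ ⊗≫ dual Y' ◁ (ev X ▷ Y) ⊗≫ (dualMap g ▷ Y ≫ ev Y) := by
      rw [← whisker_exchange]; monoidal
    _ = 𝟙 _ ⊗≫ dual Y' ◁ (ev X ▷ Y ≫ 𝟙_ C ◁ g) ⊗≫ ev Y' := by
      rw [dualMap_ev]; monoidal
    _ = _ := by rw [← whisker_exchange]; monoidal

lemma dualTensorIso_assoc (X Y Z : C) :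
    (dualTensorIso Y Z).hom ▷ dual X ≫ (dualTensorIso X (Y ⊗ Z)).hom =
      (α_ _ _ _).hom ≫ dual Z ◁ (dualTensorIso X Y).hom ≫ (dualTensorIso (X ⊗ Y) Z).hom ≫
        dualMap (α_ X Y Z).inv := by
  apply dual_hom_ext
  simp only [comp_whiskerRight, Category.assoc, dualTensorIso_ev, dualMap_ev]
  rw [← whisker_exchange_assoc (dualTensorIso (X ⊗ Y) Z).hom (α_ X Y Z).inv, dualTensorIso_ev]
  calc
    _ = 𝟙 _ ⊗≫ ((dualTensorIso Y Z).hom ▷ ((dual X ⊗ X) ⊗ (Y ⊗ Z)) ≫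
          dual (Y ⊗ Z) ◁ (ev X ▷ (Y ⊗ Z))) ⊗≫ ev (Y ⊗ Z) := by monoidal
    _ = 𝟙 _ ⊗≫ (dual Z ⊗ dual Y) ◁ (ev X ▷ (Y ⊗ Z)) ⊗≫
          ((dualTensorIso Y Z).hom ▷ (Y ⊗ Z) ≫ ev (Y ⊗ Z)) := by
      rw [← whisker_exchange]; monoidal
    _ = 𝟙 _ ⊗≫ dual Z ◁ ((𝟙 ((dual Y ⊗ dual X) ⊗ X ⊗ Y) ⊗≫ dual Y ◁ (ev X ▷ Y) ⊗≫ ev Y) ▷ Z) ⊗≫ ev Z := by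
      rw [dualTensorIso_ev]; monoidal
    _ = 𝟙 _ ⊗≫ dual Z ◁ (((dualTensorIso X Y).hom ▷ (X ⊗ Y) ≫ ev (X ⊗ Y)) ▷ Z) ⊗≫ ev Z := by
      rw [dualTensorIso_ev]
    _ = _ := by monoidal

lemma dualTensorIso_unit_left (X : C) :
    dual X ◁ dualUnitIso.hom ≫ (dualTensorIso (𝟙_ C) X).hom =
      (ρ_ (dual X)).hom ≫ dualMap (λ_ X).hom := by
  apply dual_hom_ext
  simp only [comp_whiskerRight, Category.assoc, dualTensorIso_ev, dualMap_ev]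
  calc
    _ = 𝟙 _ ⊗≫ dual X ◁ ((dualUnitIso.hom ▷ 𝟙_ C ≫ ev (𝟙_ C)) ▷ X) ⊗≫ ev X := by monoidal
    _ = _ := by rw [dualUnitIso_ev]; monoidal

lemma dualTensorIso_unit_right (X : C) :
    dualUnitIso.hom ▷ dual X ≫ (dualTensorIso X (𝟙_ C)).hom =
      (λ_ (dual X)).hom ≫ dualMap (ρ_ X).hom := by
  apply dual_hom_ext
  simp only [comp_whiskerRight, Category.assoc, dualTensorIso_ev, dualMap_ev]
  calc
    _ = 𝟙 _ ⊗≫ (dualUnitIso.hom ▷ ((dual X ⊗ X) ⊗ 𝟙_ C) ≫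
          dual (𝟙_ C) ◁ (ev X ▷ 𝟙_ C)) ⊗≫ ev (𝟙_ C) := by monoidal
    _ = 𝟙 _ ⊗≫ ev X ⊗≫ (dualUnitIso.hom ▷ 𝟙_ C ≫ ev (𝟙_ C)) := by
      rw [← whisker_exchange]; monoidal
    _ = _ := by rw [dualUnitIso_ev]; monoidal

variable (C) in
/-- The double dual functor `X ↦ X^{**}`. -/
@[simps]
def doubleDual : C ⥤ C where
  obj X := dual (dual X)
  map f := dualMap (dualMap f)
  map_id X := by simp only [dualMap_id]
  map_comp f g := by simp only [dualMap_comp]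

/-- The dual of an isomorphism. -/
@[simps]
def dualIso {X Y : C} (e : X ≅ Y) : dual Y ≅ dual X where
  hom := dualMap e.hom
  inv := dualMap e.inv
  hom_inv_id := by rw [← dualMap_comp, e.inv_hom_id, dualMap_id]
  inv_hom_id := by rw [← dualMap_comp, e.hom_inv_id, dualMap_id]

/-- The canonical isomorphism `𝟙 ≅ 𝟙^{**}`. -/
def ddUnitIso : 𝟙_ C ≅ dual (dual (𝟙_ C)) :=
  dualUnitIso ≪≫ dualIso dualUnitIso.symm

/-- The canonical isomorphism `X^{**} ⊗ Y^{**} ≅ (X ⊗ Y)^{**}`. -/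
def ddTensorIso (X Y : C) : dual (dual X) ⊗ dual (dual Y) ≅ dual (dual (X ⊗ Y)) :=
  dualTensorIso (dual Y) (dual X) ≪≫ dualIso (dualTensorIso X Y).symm

lemma ddTensorIso_hom (X Y : C) : (ddTensorIso X Y).hom =
    (dualTensorIso (dual Y) (dual X)).hom ≫ dualMap (dualTensorIso X Y).inv := rfl

lemma ddUnitIso_hom : (ddUnitIso (C := C)).hom = dualUnitIso.hom ≫ dualMap dualUnitIso.inv := rfl

lemma ddTensorIso_natural_left {X Y : C} (f : X ⟶ Y) (Z : C) :
    dualMap (dualMap f) ▷ dual (dual Z) ≫ (ddTensorIso Y Z).hom =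
      (ddTensorIso X Z).hom ≫ dualMap (dualMap (f ▷ Z)) := by
  rw [ddTensorIso_hom, ddTensorIso_hom, reassoc_of% dualTensorIso_naturality_right, Category.assoc,
    ← dualMap_comp, ← dualMap_comp]
  congr 2
  rw [Iso.inv_comp_eq, ← reassoc_of% dualTensorIso_naturality_left, Iso.hom_inv_id, Category.comp_id]

lemma ddTensorIso_natural_right (Z : C) {X Y : C} (f : X ⟶ Y) :
    dual (dual Z) ◁ dualMap (dualMap f) ≫ (ddTensorIso Z Y).hom =
      (ddTensorIso Z X).hom ≫ dualMap (dualMap (Z ◁ f)) := by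
  rw [ddTensorIso_hom, ddTensorIso_hom, reassoc_of% dualTensorIso_naturality_left, Category.assoc,
    ← dualMap_comp, ← dualMap_comp]
  congr 2
  rw [Iso.inv_comp_eq, ← reassoc_of% dualTensorIso_naturality_right, Iso.hom_inv_id, Category.comp_id]

lemma ddTensorIso_assoc (X Y Z : C) :
    (ddTensorIso X Y).hom ▷ dual (dual Z) ≫ (ddTensorIso (X ⊗ Y) Z).hom ≫
        dualMap (dualMap (α_ X Y Z).hom) =
      (α_ _ _ _).hom ≫ dual (dual X) ◁ (ddTensorIso Y Z).hom ≫ (ddTensorIso X (Y ⊗ Z)).hom := by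
  simp only [ddTensorIso_hom, comp_whiskerRight, MonoidalCategory.whiskerLeft_comp, Category.assoc]
  rw [reassoc_of% dualTensorIso_naturality_right, reassoc_of% dualTensorIso_naturality_left,
    reassoc_of% (dualTensorIso_assoc (dual Z) (dual Y) (dual X))]
  congr 3
  simp only [← dualMap_comp]
  congr 1
  have h : whiskerRightIso (dualTensorIso Y Z) (dual X) ≪≫ dualTensorIso X (Y ⊗ Z) =
      α_ _ _ _ ≪≫ whiskerLeftIso (dual Z) (dualTensorIso X Y) ≪≫ dualTensorIso (X ⊗ Y) Z ≪≫
        dualIso (α_ X Y Z).symm := Iso.ext (dualTensorIso_assoc X Y Z)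
  simpa using (congrArg Iso.inv h).symm

lemma ddTensorIso_unit_left (X : C) :
    (λ_ (dual (dual X))).hom =
      ddUnitIso.hom ▷ dual (dual X) ≫ (ddTensorIso (𝟙_ C) X).hom ≫ dualMap (dualMap (λ_ X).hom) := by
  simp only [ddTensorIso_hom, ddUnitIso_hom, comp_whiskerRight, Category.assoc]
  rw [reassoc_of% dualTensorIso_naturality_right, reassoc_of% (dualTensorIso_unit_right (dual X))]
  simp only [← dualMap_comp]
  have h : whiskerLeftIso (dual X) dualUnitIso ≪≫ dualTensorIso (𝟙_ C) X =
      ρ_ (dual X) ≪≫ dualIso (λ_ X) := Iso.ext (dualTensorIso_unit_left X)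
  have h' := congrArg (fun e => dualMap ((dualIso (λ_ X)).hom ≫ e ≫ (ρ_ (dual X)).hom))
    (congrArg Iso.inv h)
  have h'' : (dualIso (λ_ X)).hom ≫ (ρ_ (dual X) ≪≫ dualIso (λ_ X)).inv ≫ (ρ_ (dual X)).hom =
    𝟙 _ := by rw [Iso.trans_inv, Category.assoc, Iso.inv_hom_id, Category.comp_id, Iso.hom_inv_id]
  simp only [h'', dualMap_id] at h'
  simp only [Iso.trans_inv, whiskerLeftIso_inv, dualIso_hom, Category.assoc] at h'
  simp only [Category.assoc]
  rw [h', Category.comp_id]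

lemma ddTensorIso_unit_right (X : C) :
    (ρ_ (dual (dual X))).hom =
      dual (dual X) ◁ ddUnitIso.hom ≫ (ddTensorIso X (𝟙_ C)).hom ≫ dualMap (dualMap (ρ_ X).hom) := by
  simp only [ddTensorIso_hom, ddUnitIso_hom, MonoidalCategory.whiskerLeft_comp, Category.assoc]
  rw [reassoc_of% dualTensorIso_naturality_left, reassoc_of% (dualTensorIso_unit_left (dual X))]
  simp only [← dualMap_comp]
  have h : whiskerRightIso dualUnitIso (dual X) ≪≫ dualTensorIso X (𝟙_ C) =
      λ_ (dual X) ≪≫ dualIso (ρ_ X) := Iso.ext (dualTensorIso_unit_right X)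
  have h' := congrArg (fun e => dualMap ((dualIso (ρ_ X)).hom ≫ e ≫ (λ_ (dual X)).hom))
    (congrArg Iso.inv h)
  have h'' : (dualIso (ρ_ X)).hom ≫ (λ_ (dual X) ≪≫ dualIso (ρ_ X)).inv ≫ (λ_ (dual X)).hom =
    𝟙 _ := by rw [Iso.trans_inv, Category.assoc, Iso.inv_hom_id, Category.comp_id, Iso.hom_inv_id]
  simp only [h'', dualMap_id] at h'
  simp only [Iso.trans_inv, whiskerRightIso_inv, dualIso_hom, Category.assoc] at h'
  simp only [Category.assoc]
  rw [h', Category.comp_id]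

/-- The double dual functor is a strong monoidal functor through the canonical isomorphisms. -/
instance : (doubleDual C).Monoidal :=
  Functor.CoreMonoidal.toMonoidal
    { εIso := ddUnitIso
      μIso := ddTensorIso
      μIso_hom_natural_left := ddTensorIso_natural_left
      μIso_hom_natural_right := fun Z f => ddTensorIso_natural_right Z f
      associativity := ddTensorIso_assoc
      left_unitality := ddTensorIso_unit_left
      right_unitality := ddTensorIso_unit_right }

end Duality
noncomputable section Algebras

variable {C : Type u} [Category.{v} C] [MonoidalCategory C] [RigidCategory C]

variable (C) in
/-- A pivotal structure on a rigid monoidal category: an isomorphism `X ≅ X^{**}` of monoidal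
functors. -/
structure PivotalStructure where
  /-- The underlying natural isomorphism. -/
  iso : 𝟭 C ≅ doubleDual C
  isMonoidal : NatTrans.IsMonoidal iso.hom

/-- For a morphism `lam : A ⟶ 𝟙` on an algebra `A`, the morphism
`(lam ∘ mul ⊗ A^*) ∘ (A ⊗ coev) : A ⟶ A^*`. -/
def frobeniusMap (A : Mon C) (lam : A.X ⟶ 𝟙_ C) : A.X ⟶ dual A.X :=
  (ρ_ A.X).inv ≫ A.X ◁ coev A.X ≫ (α_ A.X A.X (dual A.X)).inv ≫
    (MonObj.mul (X := A.X) ≫ lam) ▷ dual A.X ≫ (λ_ (dual A.X)).hom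

/-- `(A, lam)` is a Frobenius algebra with Frobenius form `lam`. -/
def IsFrobenius (A : Mon C) (lam : A.X ⟶ 𝟙_ C) : Prop :=
  IsIso (frobeniusMap A lam)

/-- The Nakayama automorphism `p_A^{-1} ∘ (ψ^{-1})^* ∘ ψ` of a Frobenius algebra `(A, lam)`, where
`ψ` is `frobeniusMap A lam`. -/
def nakayama (p : PivotalStructure C) (A : Mon C) (lam : A.X ⟶ 𝟙_ C) (h : IsFrobenius A lam) :
    A.X ⟶ A.X :=
  frobeniusMap A lam ≫ dualMap (@inv _ _ _ _ (frobeniusMap A lam) h) ≫ p.iso.inv.app A.X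

/-- `(A, lam)` is a symmetric Frobenius algebra: it is Frobenius, and its Nakayama automorphism is
the identity. -/
def IsSymmetricFrobenius (p : PivotalStructure C) (A : Mon C) (lam : A.X ⟶ 𝟙_ C) : Prop :=
  ∃ h : IsFrobenius A lam, nakayama p A lam h = 𝟙 A.X

end Algebras

noncomputable section ModuleCategories

variable (C : Type u) [Category.{v} C] [MonoidalCategory C]
variable (M : Type u') [Category.{v'} M] [MonoidalLeftAction C M]

/-- An internal Hom functor of a left module category `M` over `C`: for every object `m`, a right
adjoint `[m, -]` of the functor `X ↦ X ⊙ₗ m` from `C` to `M`. -/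
structure InternalHom where
  /-- The functor `[m, -]`. -/
  right (m : M) : M ⥤ C
  /-- The adjunction between `- ⊙ₗ m` and `[m, -]`. -/
  adj (m : M) : actionRight C m ⊣ right m

namespace InternalHom

variable {C M}
variable (H : InternalHom C M)

/-- The internal Hom object `[m, n]`. -/
def hom (m n : M) : C := (H.right m).obj n

/-- The bijection `Hom(X ⊙ₗ m, n) ≃ Hom(X, [m, n])`. -/
def curry {X : C} {m n : M} : (X ⊙ₗ m ⟶ n) ≃ (X ⟶ H.hom m n) := (H.adj m).homEquiv X n

/-- The evaluation `[m, n] ⊙ₗ m ⟶ n`, i.e. the counit of the adjunction. -/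
def eval (m n : M) : H.hom m n ⊙ₗ m ⟶ n := (H.adj m).counit.app n

/-- The functoriality `[m, g] : [m, n] ⟶ [m, n']` for `g : n ⟶ n'`. -/
def map (m : M) {n n' : M} (g : n ⟶ n') : H.hom m n ⟶ H.hom m n' := (H.right m).map g

/-- The functoriality `[f, n] : [m', n] ⟶ [m, n]` for `f : m ⟶ m'`. -/
def premap {m m' : M} (f : m ⟶ m') (n : M) : H.hom m' n ⟶ H.hom m n :=
  H.curry (H.hom m' n ⊴ₗ f ≫ H.eval m' n)

/-- The identity `𝟙 ⟶ [m, m]`. -/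
def ident (m : M) : 𝟙_ C ⟶ H.hom m m := H.curry (λₗ m).hom

/-- The composition `[m, n] ⊗ [l, m] ⟶ [l, n]`. -/
def comp (l m n : M) : H.hom m n ⊗ H.hom l m ⟶ H.hom l n :=
  H.curry ((αₗ (H.hom m n) (H.hom l m) l).hom ≫ H.hom m n ⊴ₗ H.eval l m ≫ H.eval m n)

lemma curry_eval {X : C} {m n : M} (f : X ⊙ₗ m ⟶ n) : H.curry f ⊵ₗ m ≫ H.eval m n = f :=
  ((H.adj m).homEquiv_counit (X := X) (g := H.curry f)).symm.trans
    (((H.adj m).homEquiv X n).symm_apply_apply f)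

lemma hom_ext {X : C} {m n : M} {f g : X ⟶ H.hom m n}
    (h : f ⊵ₗ m ≫ H.eval m n = g ⊵ₗ m ≫ H.eval m n) : f = g :=
  ((H.adj m).homEquiv X n).symm.injective
    (((H.adj m).homEquiv_counit (g := f)).trans (h.trans ((H.adj m).homEquiv_counit (g := g)).symm))

lemma ident_eval (m : M) : H.ident m ⊵ₗ m ≫ H.eval m m = (λₗ m).hom := H.curry_eval _

lemma comp_eval (l m n : M) : H.comp l m n ⊵ₗ l ≫ H.eval l n =
    (αₗ (H.hom m n) (H.hom l m) l).hom ≫ H.hom m n ⊴ₗ H.eval l m ≫ H.eval m n := H.curry_eval _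

lemma ident_comp (m n : M) : H.ident n ▷ H.hom m n ≫ H.comp m n n = (λ_ (H.hom m n)).hom := by
  apply H.hom_ext
  rw [comp_actionHomLeft, Category.assoc, comp_eval, whiskerRight_actionHomLeft]
  simp only [Category.assoc, Iso.inv_hom_id_assoc]
  rw [← action_exchange_assoc, ident_eval, leftUnitor_actionHom, Category.assoc,
    actionUnitIso_hom_naturality]

lemma comp_ident (m n : M) : H.hom m n ◁ H.ident m ≫ H.comp m m n = (ρ_ (H.hom m n)).hom := by
  apply H.hom_ext
  rw [comp_actionHomLeft, Category.assoc, comp_eval, whiskerLeft_actionHomLeft]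
  simp only [Category.assoc, Iso.inv_hom_id_assoc]
  rw [← actionHomRight_comp_assoc, ident_eval, rightUnitor_actionHom, Category.assoc]

lemma comp_assoc (l m n o : M) :
    H.comp m n o ▷ H.hom l m ≫ H.comp l m o =
      (α_ _ _ _).hom ≫ H.hom n o ◁ H.comp l m n ≫ H.comp l n o := by
  apply H.hom_ext
  rw [comp_actionHomLeft, comp_actionHomLeft, comp_actionHomLeft, Category.assoc, Category.assoc,
    Category.assoc, comp_eval, comp_eval, whiskerRight_actionHomLeft, whiskerLeft_actionHomLeft]
  simp only [Category.assoc, Iso.inv_hom_id_assoc]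
  rw [← action_exchange_assoc, comp_eval, ← actionHomRight_comp_assoc, comp_eval]
  simp only [actionHomRight_comp, Category.assoc, tensor_actionHomRight, Iso.inv_hom_id_assoc]
  rw [associator_actionHom_assoc]

/-- The internal endomorphism algebra `[m, m]`, whose multiplication is the composition. -/
def endAlgebra (m : M) : Mon C where
  X := H.hom m m
  mon :=
    { one := H.ident m
      mul := H.comp m m m
      one_mul := H.ident_comp m m
      mul_one := H.comp_ident m m
      mul_assoc := H.comp_assoc m m m m }

/-- The left module structure `X ⊗ [m, n] ⟶ [m, X ⊙ₗ n]` of the internal Hom functor. -/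
def actLeft (X : C) (m n : M) : X ⊗ H.hom m n ⟶ H.hom m (X ⊙ₗ n) :=
  H.curry ((αₗ X (H.hom m n) m).hom ≫ X ⊴ₗ H.eval m n)

variable [RigidCategory C]

/-- The right module structure `[m, n] ⊗ X^* ⟶ [X ⊙ₗ m, n]` of the internal Hom functor. -/
def actRight (X : C) (m n : M) : H.hom m n ⊗ dual X ⟶ H.hom (X ⊙ₗ m) n :=
  H.curry ((αₗ (H.hom m n ⊗ dual X) X m).inv ≫ (α_ (H.hom m n) (dual X) X).hom ⊵ₗ m ≫
    (H.hom m n ◁ ev X ≫ (ρ_ (H.hom m n)).hom) ⊵ₗ m ≫ H.eval m n)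

end InternalHom

variable {C M}
variable [RigidCategory C]

/-- A relative Serre functor of `M`: an endofunctor `S` with isomorphisms
`φ m n : [m, n]^* ≅ [n, S m]` that are natural in `m` and in `n`. -/
structure RelativeSerreFunctor (H : InternalHom C M) where
  /-- The underlying endofunctor. -/
  S : M ⥤ M
  /-- The isomorphism `[m, n]^* ≅ [n, S m]`. -/
  φ (m n : M) : dual (H.hom m n) ≅ H.hom n (S.obj m)
  φ_natural_left {m m' : M} (f : m ⟶ m') (n : M) :
    dualMap (H.premap f n) ≫ (φ m' n).hom = (φ m n).hom ≫ H.map n (S.map f)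
  φ_natural_right (m : M) {n n' : M} (g : n ⟶ n') :
    dualMap (H.map m g) ≫ (φ m n).hom = (φ m n').hom ≫ H.premap g (S.obj m)

/-- The twisted module structure of a relative Serre functor `(S, φ)`: morphisms
`ξ X m : X^{**} ⊙ₗ S m ⟶ S (X ⊙ₗ m)` that make `S` a module functor from `M` to `M` with the action
twisted by the double dual functor, and for which `φ` is an isomorphism of bimodule functors.
The latter determines `ξ` uniquely. -/
structure TwistedModuleStructure {H : InternalHom C M} (R : RelativeSerreFunctor H) where
  /-- The structure morphism. -/
  ξ (X : C) (m : M) : dual (dual X) ⊙ₗ R.S.obj m ⟶ R.S.obj (X ⊙ₗ m)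
  ξ_natural_left {X Y : C} (f : X ⟶ Y) (m : M) :
    dualMap (dualMap f) ⊵ₗ R.S.obj m ≫ ξ Y m = ξ X m ≫ R.S.map (f ⊵ₗ m)
  ξ_natural_right (X : C) {m n : M} (g : m ⟶ n) :
    dual (dual X) ⊴ₗ R.S.map g ≫ ξ X n = ξ X m ≫ R.S.map (X ⊴ₗ g)
  ξ_unit (m : M) :
    ddUnitIso.hom ⊵ₗ R.S.obj m ≫ ξ (𝟙_ C) m ≫ R.S.map (λₗ m).hom = (λₗ (R.S.obj m)).hom
  ξ_tensor (X Y : C) (m : M) :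
    (ddTensorIso X Y).hom ⊵ₗ R.S.obj m ≫ ξ (X ⊗ Y) m ≫ R.S.map (αₗ X Y m).hom =
      (αₗ (dual (dual X)) (dual (dual Y)) (R.S.obj m)).hom ≫
        dual (dual X) ⊴ₗ ξ Y m ≫ ξ X (Y ⊙ₗ m)
  /-- The map `φ` is compatible with the left actions on
  `X^{**} ⊗ [m, n]^* ≅ ([m, n] ⊗ X^*)^* ≅ [X ⊙ₗ m, n]^*` and on
  `X^{**} ⊗ [n, S m] ≅ [n, X^{**} ⊙ₗ S m] ≅ [n, S (X ⊙ₗ m)]`. -/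
  φ_left (X : C) (m n : M) :
    H.actLeft (dual (dual X)) n (R.S.obj m) ≫ H.map n (ξ X m) ≫ (R.φ (X ⊙ₗ m) n).inv ≫
        dualMap (H.actRight X m n) =
      dual (dual X) ◁ (R.φ m n).inv ≫ (dualTensorIso (H.hom m n) (dual X)).hom
  /-- The map `φ` is compatible with the right actions on
  `[m, n]^* ⊗ X^* ≅ (X ⊗ [m, n])^* ≅ [m, X ⊙ₗ n]^*` and on `[n, S m] ⊗ X^* ≅ [X ⊙ₗ n, S m]`. -/
  φ_right (X : C) (m n : M) :
    dualMap (H.actLeft X m n) ≫ (dualTensorIso X (H.hom m n)).inv ≫ (R.φ m n).hom ▷ dual X ≫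
        H.actRight X n (R.S.obj m) =
      (R.φ m (X ⊙ₗ n)).hom

/-- A pivotal structure of a module category `M` with relative Serre functor `(S, φ)` and its
twisted module structure `ξ`, respecting the pivotal structure `p` of `C`. -/
structure ModulePivotalStructure (p : PivotalStructure C) {H : InternalHom C M}
    {R : RelativeSerreFunctor H} (T : TwistedModuleStructure R) where
  /-- The underlying natural isomorphism. -/
  iso : 𝟭 M ≅ R.S
  compatible (X : C) (m : M) :
    iso.hom.app (X ⊙ₗ m) = (p.iso.hom.app X ⊙ₗₘ iso.hom.app m) ≫ T.ξ X m

/-- The trace `[m, S m] ⟶ 𝟙` on the object `m`. -/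
def RelativeSerreFunctor.trace {H : InternalHom C M} (R : RelativeSerreFunctor H) (m : M) :
    H.hom m (R.S.obj m) ⟶ 𝟙_ C :=
  (R.φ m m).inv ≫ dualMap (H.ident m) ≫ dualUnitIso.inv

end ModuleCategories

section Finiteness

variable (k : Type w) [Field k]

/-- A finite abelian category over `k`: a `k`-linear abelian category that is equivalent to the
category of finite-dimensional left modules over some finite-dimensional `k`-algebra. (Over such an
algebra, a module is finitely generated if and only if it is finite-dimensional over `k`.) -/
def IsFiniteAbelian (C : Type u) [Category.{v} C] [Abelian C] [Linear k C] : Prop :=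
  ∃ (A : Type w) (_ : Ring A) (_ : Algebra k A) (_ : Module.Finite k A)
    (e : C ≌ FGModuleCat.{w} A), e.functor.Additive ∧ e.functor.Linear k

/-- A finite tensor category over `k`. -/
structure IsFiniteTensorCategory (C : Type u) [Category.{v} C] [Abelian C] [Linear k C]
    [MonoidalCategory C] [RigidCategory C] : Prop where
  finite : IsFiniteAbelian k C
  preadditive : MonoidalPreadditive C
  linear : MonoidalLinear k C
  simple_unit : Simple (𝟙_ C)

/-- A finite left module category `M` over `C`. -/
structure IsFiniteModuleCategory (C : Type u) [Category.{v} C] [Abelian C] [Linear k C]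
    [MonoidalCategory C] (M : Type u') [Category.{v'} M] [Abelian M] [Linear k M]
    [MonoidalLeftAction C M] : Prop where
  finite : IsFiniteAbelian k M
  additive_left (X : C) : (actionLeft M X).Additive
  linear_left (X : C) : (actionLeft M X).Linear k
  additive_right (m : M) : (actionRight C m).Additive
  linear_right (m : M) : (actionRight C m).Linear k
  rightExact_left (X : C) : PreservesFiniteColimits (actionLeft M X)
  rightExact_right (m : M) : PreservesFiniteColimits (actionRight C m)

/-- An exact left module category `M` over `C`. -/
structure IsExactModuleCategory (C : Type u) [Category.{v} C] [Abelian C] [Linear k C]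
    [MonoidalCategory C] (M : Type u') [Category.{v'} M] [Abelian M] [Linear k M]
    [MonoidalLeftAction C M] : Prop extends IsFiniteModuleCategory k C M where
  projective_action (P : C) [Projective P] (m : M) : Projective (P ⊙ₗ m)

end Finiteness

end RelSerre

namespace RelSerre

/-! ### Duality calculus: zigzags, the Frobenius pairing, duals of units and coevaluations. -/

section Duality

variable {C : Type u} [Category.{v} C] [MonoidalCategory C] [RigidCategory C]

/-! Write `A = [m, m]`, let `π` be the pivotal structure at `A`, and `ψ` the Frobenius map. A
morphism into `A^*` is determined by its pairing with `A`, so it suffices to compute the form `λ ∘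
μ` in two ways.

Compatibility of `φ` with the right actions shows that composing `[m, S m] ⊗ [m, m]` and taking the
trace is evaluation, once `[m, S m]` is identified with `A^*` (`φ_comp_trace`). Hence `ψ` is `[m,
f]` followed by the inverse of `φ`, where `f : m ≅ S m` is the pivotal structure at `m`. It is
therefore invertible, and `λ ∘ μ = ev_A ∘ (ψ ⊗ A)`.

Compatibility of `φ` with the left actions, together with the pivotal condition along the evaluation
`A ⊙ₗ m ⟶ m`, gives `λ ∘ μ = ev_{A^*} ∘ (π ⊗ ψ)` (`comp_map_trace`). Comparing the two yields `ψ =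
ψ^* ∘ π`, which says that the Nakayama automorphism is trivial. -/

lemma coev_ev (X : C) : coev X ▷ X ⊗≫ X ◁ ev X = ⊗𝟙.hom := by
  have h : coev X ▷ X ≫ (α_ X (dual X) X).hom ≫ X ◁ ev X = (λ_ X).hom ≫ (ρ_ X).inv :=
    ExactPairing.evaluation_coevaluation' (C := C) (X := X) (Y := Xᘁ)
  simp only [monoidalComp, MonoidalCoherence.iso]
  simpa using h

lemma ev_coev (X : C) : dual X ◁ coev X ⊗≫ ev X ▷ dual X = ⊗𝟙.hom := by
  have h : dual X ◁ coev X ≫ (α_ (dual X) X (dual X)).inv ≫ ev X ▷ dual X =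
      (ρ_ (dual X)).hom ≫ (λ_ (dual X)).inv :=
    ExactPairing.coevaluation_evaluation' (C := C) (X := X) (Y := Xᘁ)
  simp only [monoidalComp, MonoidalCoherence.iso]
  simpa using h

/-- A zigzag cancels the coevaluation in the definition; the resulting identity characterizes the
Frobenius map. -/
lemma frobeniusMap_ev (A : Mon C) (lam : A.X ⟶ 𝟙_ C) :
    frobeniusMap A lam ▷ A.X ≫ ev A.X = MonObj.mul (X := A.X) ≫ lam := by
  rw [frobeniusMap]
  set g := MonObj.mul (X := A.X) ≫ lam
  calc
    _ = 𝟙 _ ⊗≫ A.X ◁ (coev A.X ▷ A.X) ⊗≫ (g ▷ (dual A.X ⊗ A.X) ≫ 𝟙_ C ◁ ev A.X) ⊗≫ 𝟙 _ := by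
      monoidal
    _ = 𝟙 _ ⊗≫ A.X ◁ (coev A.X ▷ A.X ⊗≫ A.X ◁ ev A.X) ⊗≫ g := by
      rw [← whisker_exchange]; monoidal
    _ = _ := by rw [coev_ev]; monoidal

/-- After pairing with the unit object this is the zigzag for `X`. It lets the evaluation of `X^*`
emerge from a dualized coevaluation in `comp_map_trace`. -/
lemma dualTensorIso_dualMap_coev (X : C) :
    (dualTensorIso X (dual X)).hom ≫ dualMap (coev X) = ev (dual X) ≫ dualUnitIso.hom := by
  apply dual_hom_ext
  rw [comp_whiskerRight, comp_whiskerRight, Category.assoc, Category.assoc, dualMap_ev,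
    dualUnitIso_ev, ← whisker_exchange_assoc, dualTensorIso_ev]
  calc
    _ = 𝟙 _ ⊗≫ dual (dual X) ◁ (dual X ◁ coev X ⊗≫ ev X ▷ dual X) ⊗≫ ev (dual X) := by monoidal
    _ = _ := by rw [ev_coev]; monoidal

/-- The dual of a right unit law, used for composition in `[m, n]` with the identity of `m`. -/
lemma dualMap_dualTensorIso_inv {X Y : C} (u : 𝟙_ C ⟶ Y) (c : X ⊗ Y ⟶ X)
    (h : X ◁ u ≫ c = (ρ_ X).hom) :
    dualMap c ≫ (dualTensorIso X Y).inv ≫ (dualMap u ≫ dualUnitIso.inv) ▷ dual X =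
      (λ_ (dual X)).inv := by
  have h₁ : (dualTensorIso X Y).inv ≫ dualMap u ▷ dual X =
      dualMap (X ◁ u) ≫ (dualTensorIso X (𝟙_ C)).inv := by
    rw [Iso.inv_comp_eq, ← reassoc_of% dualTensorIso_naturality_right, Iso.hom_inv_id,
      Category.comp_id]
  have h₂ : dualMap (ρ_ X).hom ≫ (dualTensorIso X (𝟙_ C)).inv =
      (λ_ (dual X)).inv ≫ dualUnitIso.hom ▷ dual X := by
    rw [Iso.eq_inv_comp, ← reassoc_of% dualTensorIso_unit_right, Iso.hom_inv_id, Category.comp_id]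
  rw [comp_whiskerRight, reassoc_of% h₁, ← Category.assoc, ← dualMap_comp, h, reassoc_of% h₂,
    hom_inv_whiskerRight, Category.comp_id]

end Duality

/-! ### Internal Homs: composition expressed through the two actions. -/

section InternalHom

variable {C : Type u} [Category.{v} C] [MonoidalCategory C]
variable {M : Type u'} [Category.{v'} M] [MonoidalLeftAction C M]

namespace InternalHom

variable (H : InternalHom C M)

lemma map_eval (m : M) {n n' : M} (g : n ⟶ n') :
    H.map m g ⊵ₗ m ≫ H.eval m n' = H.eval m n ≫ g :=
  (H.adj m).counit.naturality g

lemma premap_eval {m m' : M} (f : m ⟶ m') (n : M) :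
    H.premap f n ⊵ₗ m ≫ H.eval m n = H.hom m' n ⊴ₗ f ≫ H.eval m' n := H.curry_eval _

lemma actLeft_eval (X : C) (m n : M) : H.actLeft X m n ⊵ₗ m ≫ H.eval m (X ⊙ₗ n) =
    (αₗ X (H.hom m n) m).hom ≫ X ⊴ₗ H.eval m n := H.curry_eval _

lemma map_comp (m : M) {n n' n'' : M} (g : n ⟶ n') (g' : n' ⟶ n'') :
    H.map m (g ≫ g') = H.map m g ≫ H.map m g' := (H.right m).map_comp g g'

/-- Expressing composition by the left action lets the compatibilities of `φ` and `ξ` with that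
action speak about multiplication. -/
lemma actLeft_map_eval (l m n : M) :
    H.actLeft (H.hom m n) l m ≫ H.map l (H.eval m n) = H.comp l m n := by
  apply H.hom_ext
  rw [comp_actionHomLeft, Category.assoc, map_eval, ← Category.assoc, actLeft_eval, comp_eval,
    Category.assoc]

lemma comp_map (l m : M) {n n' : M} (g : n ⟶ n') :
    H.comp l m n ≫ H.map l g = H.map m g ▷ H.hom l m ≫ H.comp l m n' := by
  apply H.hom_ext
  rw [comp_actionHomLeft, comp_actionHomLeft, Category.assoc, Category.assoc, map_eval, comp_eval,
    ← Category.assoc, comp_eval, whiskerRight_actionHomLeft]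
  simp only [Category.assoc, Iso.inv_hom_id_assoc]
  rw [← action_exchange_assoc, map_eval]

lemma actLeft_naturality {X Y : C} (f : X ⟶ Y) (l : M) {m n : M} (g : m ⟶ n) :
    H.actLeft X l m ≫ H.map l (f ⊙ₗₘ g) = (f ⊗ₘ H.map l g) ≫ H.actLeft Y l n := by
  apply H.hom_ext
  rw [comp_actionHomLeft, comp_actionHomLeft, Category.assoc, Category.assoc, map_eval,
    actLeft_eval, ← Category.assoc, actLeft_eval, MonoidalCategory.tensorHom_def, comp_actionHomLeft,
    whiskerRight_actionHomLeft, whiskerLeft_actionHomLeft, actionHom_def]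
  simp only [Category.assoc, Iso.inv_hom_id_assoc]
  rw [← action_exchange_assoc, ← action_exchange, ← action_exchange, ← actionHomRight_comp_assoc,
    ← actionHomRight_comp_assoc, map_eval]

/-- The composition with the tautological morphism `X ⟶ [m, X ⊙ₗ m]`. -/
def uncurryLeft (X : C) (m n : M) : H.hom (X ⊙ₗ m) n ⊗ X ⟶ H.hom m n :=
  H.curry ((αₗ (H.hom (X ⊙ₗ m) n) X m).hom ≫ H.eval (X ⊙ₗ m) n)

lemma uncurryLeft_eval (X : C) (m n : M) : H.uncurryLeft X m n ⊵ₗ m ≫ H.eval m n =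
    (αₗ (H.hom (X ⊙ₗ m) n) X m).hom ≫ H.eval (X ⊙ₗ m) n := H.curry_eval _

lemma premap_eval_uncurryLeft (l m n : M) :
    H.premap (H.eval l m) n ▷ H.hom l m ≫ H.uncurryLeft (H.hom l m) l n = H.comp l m n := by
  apply H.hom_ext
  rw [comp_actionHomLeft, Category.assoc, uncurryLeft_eval, comp_eval, whiskerRight_actionHomLeft]
  simp only [Category.assoc, Iso.inv_hom_id_assoc]
  rw [premap_eval]

/-- This is the injectivity of `Hom(Y, [X ⊙ₗ m, n]) ≅ Hom(Y ⊗ X, [m, n])`. -/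
lemma uncurryLeft_ext {X : C} {m n : M} {Y : C} {f g : Y ⟶ H.hom (X ⊙ₗ m) n}
    (h : f ▷ X ≫ H.uncurryLeft X m n = g ▷ X ≫ H.uncurryLeft X m n) : f = g := by
  apply H.hom_ext
  have h' := congrArg (fun t => (αₗ Y X m).inv ≫ t ⊵ₗ m ≫ H.eval m n) h
  simp only [comp_actionHomLeft, Category.assoc, uncurryLeft_eval, whiskerRight_actionHomLeft,
    Iso.inv_hom_id_assoc] at h'
  exact h'

variable [RigidCategory C]

lemma actRight_eval (X : C) (m n : M) : H.actRight X m n ⊵ₗ (X ⊙ₗ m) ≫ H.eval (X ⊙ₗ m) n =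
    (αₗ (H.hom m n ⊗ dual X) X m).inv ≫ (α_ (H.hom m n) (dual X) X).hom ⊵ₗ m ≫
      (H.hom m n ◁ ev X ≫ (ρ_ (H.hom m n)).hom) ⊵ₗ m ≫ H.eval m n := H.curry_eval _

lemma actRight_uncurryLeft (X : C) (m n : M) :
    H.actRight X m n ▷ X ≫ H.uncurryLeft X m n =
      (α_ (H.hom m n) (dual X) X).hom ≫ H.hom m n ◁ ev X ≫ (ρ_ (H.hom m n)).hom := by
  apply H.hom_ext
  rw [comp_actionHomLeft, Category.assoc, uncurryLeft_eval, whiskerRight_actionHomLeft]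
  simp only [Category.assoc, Iso.inv_hom_id_assoc]
  rw [actRight_eval]
  simp only [Iso.hom_inv_id_assoc, comp_actionHomLeft, Category.assoc]

/-- Both sides are transposes of the identity of `[m, n]`: one by the unit law of composition, the
other by a zigzag. Dualized, this turns the unit inside the trace into a coevaluation. -/
lemma ident_premap_eval (m n : M) :
    H.ident n ≫ H.premap (H.eval m n) n = coev (H.hom m n) ≫ H.actRight (H.hom m n) m n := by
  apply H.uncurryLeft_ext
  rw [comp_whiskerRight, comp_whiskerRight, Category.assoc, Category.assoc, actRight_uncurryLeft,
    premap_eval_uncurryLeft, ident_comp]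
  calc
    -- The coherence isomorphism is isolated so that the zigzag can be inserted in its place.
    _ = 𝟙 _ ⊗≫ (⊗𝟙.hom : 𝟙_ C ⊗ H.hom m n ⟶ H.hom m n ⊗ 𝟙_ C) ⊗≫ 𝟙 _ := by monoidal
    _ = _ := by rw [← coev_ev]; monoidal

end InternalHom

/-! ### Relative Serre functors: trace pairings and symmetry. -/

variable [RigidCategory C] {H : InternalHom C M}

/-- Naturality of `φ` along `H.eval m n` and compatibility with the right action express `φ m n`
through `φ m m`, which cancels against its inverse in the trace; the unit law then leaves only the
evaluation. -/
lemma RelativeSerreFunctor.φ_comp_trace (R : RelativeSerreFunctor H)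
    (T : TwistedModuleStructure R) (m n : M) :
    (R.φ m n).hom ▷ H.hom m n ≫ H.comp m n (R.S.obj m) ≫ R.trace m = ev (H.hom m n) := by
  have h₁ : dualMap (H.comp m m n) ≫ (dualTensorIso (H.hom m n) (H.hom m m)).inv ≫
      (R.φ m m).hom ▷ dual (H.hom m n) ≫ H.actRight (H.hom m n) m (R.S.obj m) =
        (R.φ m n).hom ≫ H.premap (H.eval m n) (R.S.obj m) := by
    rw [← R.φ_natural_right m (H.eval m n), ← T.φ_right, ← H.actLeft_map_eval, dualMap_comp, Category.assoc]
  -- Pairing with `[m, n]` turns the right action into `ev` and precomposition with the evaluation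
  -- into `comp`.
  have h₂ := congrArg (fun t => t ▷ H.hom m n ≫ H.uncurryLeft (H.hom m n) m (R.S.obj m)) h₁
  simp only [comp_whiskerRight, Category.assoc, H.actRight_uncurryLeft,
    H.premap_eval_uncurryLeft] at h₂
  have h₃ := dualMap_dualTensorIso_inv (H.ident m) (H.comp m m n) (H.comp_ident m n)
  rw [← reassoc_of% h₂, trace]
  set e := (R.φ m m).inv ≫ dualMap (H.ident m) ≫ dualUnitIso.inv with he
  have h₄ : (R.φ m m).hom ≫ e = dualMap (H.ident m) ≫ dualUnitIso.inv := by simp [he]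
  calc
    _ = dualMap (H.comp m m n) ▷ H.hom m n ≫ (dualTensorIso (H.hom m n) (H.hom m m)).inv ▷ H.hom m n
          ≫ ((R.φ m m).hom ▷ dual (H.hom m n)) ▷ H.hom m n ⊗≫
          (H.hom m (R.S.obj m) ◁ ev (H.hom m n) ≫ e ▷ 𝟙_ C) ⊗≫ 𝟙 _ := by monoidal
    _ = (dualMap (H.comp m m n) ≫ (dualTensorIso (H.hom m n) (H.hom m m)).inv ≫
          ((R.φ m m).hom ≫ e) ▷ dual (H.hom m n)) ▷ H.hom m n ⊗≫ ev (H.hom m n) := by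
      -- The trace slides past the evaluation to meet `φ m m`.
      rw [whisker_exchange]; monoidal
    _ = _ := by rw [h₄, h₃]; monoidal

variable {R : RelativeSerreFunctor H} {T : TwistedModuleStructure R} {p : PivotalStructure C}

lemma frobeniusMap_endAlgebra (T : TwistedModuleStructure R) (m : M) (f : m ⟶ R.S.obj m) :
    frobeniusMap (H.endAlgebra m) (H.map m f ≫ R.trace m) = H.map m f ≫ (R.φ m m).inv := by
  apply dual_hom_ext
  rw [frobeniusMap_ev]
  change H.comp m m m ≫ H.map m f ≫ R.trace m =
    (H.map m f ≫ (R.φ m m).inv) ▷ H.hom m m ≫ ev (H.hom m m)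
  rw [← R.φ_comp_trace T, comp_whiskerRight, Category.assoc, inv_hom_whiskerRight_assoc,
    reassoc_of% H.comp_map]

/-- The counterpart of `φ_comp_trace` for the left action: the hypothesis moves `g` across the
evaluation at the cost of `π` and `ξ`, and `T.φ_left` absorbs `ξ`. -/
lemma comp_map_trace (T : TwistedModuleStructure R) {m n : M}
    {π : H.hom m n ⟶ dual (dual (H.hom m n))} {f : m ⟶ R.S.obj m} {g : n ⟶ R.S.obj n}
    (h : H.eval m n ≫ g = (π ⊙ₗₘ f) ≫ T.ξ (H.hom m n) m ≫ R.S.map (H.eval m n)) :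
    H.comp n m n ≫ H.map n g ≫ R.trace n =
      (π ⊗ₘ H.map n f ≫ (R.φ m n).inv) ≫ ev (dual (H.hom m n)) := by
  have h₁ : H.map n (R.S.map (H.eval m n)) ≫ (R.φ n n).inv =
      (R.φ (H.hom m n ⊙ₗ m) n).inv ≫ dualMap (H.premap (H.eval m n) n) := by
    rw [Iso.eq_inv_comp, ← reassoc_of% R.φ_natural_left, Iso.hom_inv_id, Category.comp_id]
  rw [← H.actLeft_map_eval, Category.assoc, ← reassoc_of% H.map_comp, h, H.map_comp,
    H.map_comp, Category.assoc, Category.assoc, reassoc_of% H.actLeft_naturality,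
    RelativeSerreFunctor.trace, reassoc_of% h₁,
    ← reassoc_of% dualMap_comp, H.ident_premap_eval, dualMap_comp, Category.assoc,
    reassoc_of% T.φ_left, reassoc_of% dualTensorIso_dualMap_coev, Iso.hom_inv_id, Category.comp_id,
    MonoidalCategory.tensorHom_def, MonoidalCategory.tensorHom_def,
    MonoidalCategory.whiskerLeft_comp]
  simp only [Category.assoc]

/-- Moving `f` across the evaluation replaces it by its dual on the other factor, and the pairing
determines the morphism. -/
lemma eq_comp_dualMap {X : C} {π : X ⟶ dual (dual X)} {f : X ⟶ dual X}
    (h : f ▷ X ≫ ev X = (π ⊗ₘ f) ≫ ev (dual X)) : f = π ≫ dualMap f := by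
  apply dual_hom_ext
  rw [h, MonoidalCategory.tensorHom_def, comp_whiskerRight, Category.assoc, Category.assoc,
    dualMap_ev]

lemma comp_dualMap_inv_comp {X : C} {π : X ⟶ dual (dual X)} {π' : dual (dual X) ⟶ X}
    {f : X ⟶ dual X} [IsIso f] (hπ : π ≫ π' = 𝟙 X) (h : f = π ≫ dualMap f) :
    f ≫ dualMap (inv f) ≫ π' = 𝟙 X := by
  have h₁ : dualMap f ≫ dualMap (inv f) = 𝟙 _ := by
    rw [← dualMap_comp, IsIso.inv_hom_id, dualMap_id]
  calc
    -- Only the leading `f` is replaced; the one inside `inv f` must stay.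
    _ = (π ≫ dualMap f) ≫ dualMap (inv f) ≫ π' := congrArg (· ≫ dualMap (inv f) ≫ π') h
    _ = _ := by rw [Category.assoc, reassoc_of% h₁, hπ]

lemma isSymmetricFrobenius_endAlgebra (T : TwistedModuleStructure R) {m : M} (f : m ≅ R.S.obj m)
    (h : H.eval m m ≫ f.hom =
      (p.iso.hom.app (H.hom m m) ⊙ₗₘ f.hom : _ ⟶ dual (dual (H.hom m m)) ⊙ₗ R.S.obj m) ≫
        T.ξ (H.hom m m) m ≫ R.S.map (H.eval m m)) :
    IsSymmetricFrobenius p (H.endAlgebra m) (H.map m f.hom ≫ R.trace m) := by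
  have hψ := frobeniusMap_endAlgebra T m f.hom
  have hF : IsIso (frobeniusMap (H.endAlgebra m) (H.map m f.hom ≫ R.trace m)) := by
    rw [hψ]
    exact ((H.right m).mapIso f ≪≫ (R.φ m m).symm).isIso_hom
  refine ⟨hF, comp_dualMap_inv_comp (p.iso.hom_inv_id_app _) (eq_comp_dualMap ?_)⟩
  rw [frobeniusMap_ev, hψ]
  exact comp_map_trace T h

/-- Naturality along the evaluation, combined with the pivotal condition at `X = [m, n]`. -/
lemma ModulePivotalStructure.eval_comp (q : ModulePivotalStructure p T) (m n : M) :
    H.eval m n ≫ q.iso.hom.app n =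
      ((p.iso.hom.app (H.hom m n) ⊙ₗₘ q.iso.hom.app m) ≫ T.ξ (H.hom m n) m) ≫
        R.S.map (H.eval m n) :=
  (q.iso.hom.naturality (H.eval m n)).trans
    (congrArg (· ≫ R.S.map (H.eval m n)) (q.compatible (H.hom m n) m))

end InternalHom

end RelSerre

theorem mainTheorem6
    {k : Type*} [Field k] [IsAlgClosed k]
    {C : Type*} [Category* C] [Abelian C] [Linear k C] [MonoidalCategory C] [RigidCategory C]
    (hC : RelSerre.IsFiniteTensorCategory k C)
    (p : RelSerre.PivotalStructure C)
    {M : Type*} [Category* M] [Abelian M] [Linear k M] [MonoidalLeftAction C M]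
    (hM : RelSerre.IsExactModuleCategory k C M)
    (H : RelSerre.InternalHom C M)
    (R : RelSerre.RelativeSerreFunctor H)
    (T : RelSerre.TwistedModuleStructure R)
    (q : RelSerre.ModulePivotalStructure p T)
    (m : M) :
    RelSerre.IsSymmetricFrobenius p (H.endAlgebra m)
      (H.map m (q.iso.hom.app m) ≫ R.trace m) := by
  exact RelSerre.isSymmetricFrobenius_endAlgebra T (q.iso.app m)
    ((q.eval_comp m m).trans (Category.assoc _ _ _))
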